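/- Let $H$ be an infinite-dimensional separable real Hilbert space with norm $|\cdot|_H$, and let $V$ be a dense subspace of $H$ endowed with a Hilbert space structure (norm $\|\cdot\|_V$) such that the inclusion of $V$ into $H$ is compact; identify $H$ with a subspace of the dual $V'$ through $\langle h, v\rangle=(h,v)_H$. Let $A:V\to V'$ be the duality map, $\langle Au,v\rangle=(u,v)_V$, and let $0<\lambda_1\le\lambda_2\le\dots$ be the sequence of its eigenvalues ($Aw=\lambda_j w$ in $V'$, $w\in V\setminus\{0\}$), repeated according to multiplicity. Assume (H1): there are constants $c>0$ and $\alpha>0$ such that $\lambda_j\ge c\,j^{\alpha}$ for all $j\ge 1$. Let $g:V\to V'$ be continuous and nondecreasing, i.e. $\langle g(u)-g(v),u-v\rangle\ge 0$ for all $u,v\in V$, let $\lambda>0$, and let $\mathcal C=\{u\in V: Au+g(u)=\lambda u \text{ in } V'\}$. For a precompact set $M\subset H$ let $N_\varepsilon(M,H)$ be the minimal number of $\varepsilon$-balls of $H$ which cover $M$, and let $$\dim_F M=\limsup_{\varepsilon\to0^+}\frac{\log_2 N_\varepsilon(M,H)}{\log_2(1/\varepsilon)}$$ be the fractal dimension of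 $M$ (with $\dim_F\emptyset=0$). Then every compact subset $K\subset\mathcal C$ (compact in $H$) has finite fractal dimension, and $$\dim_F K<\left(\frac{\log 3+\alpha}{\log 2}\right)\left(\frac{32\lambda}{c}\right)^{1/\alpha}.$$ -/

import Mathlib

open Filter Topology
open scoped NNReal ENNReal

noncomputable section

namespace EllipsoidEntropy

section FractalDimension

variable {X : Type*} [PseudoEMetricSpace X]

/-- The Kolmogorov `ε`-entropy `log₂ N_ε(M, X)`, where `N_ε(M, X)` is the minimal number of
`ε`-balls of `X` (with arbitrary centres in `X`) which cover `M`. It is `⊤` when no finite cover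
exists. The `max 1` only concerns `M = ∅` (the only set with `N_ε(M, X) = 0`), to which entropy
`0` is given. -/
def entropy (ε : ℝ≥0) (M : Set X) : EReal :=
  ENNReal.log ((max 1 (Metric.externalCoveringNumber ε M) : ℕ∞) : ℝ≥0∞) / (Real.log 2 : EReal)

/-- The fractal dimension `limsup_{ε → 0⁺} (log₂ N_ε(M, X)) / (log₂ (1 / ε))`. -/
def fractalDim (M : Set X) : EReal :=
  limsup (fun ε : ℝ≥0 => entropy ε M / (Real.logb 2 (1 / (ε : ℝ)) : EReal)) (𝓝[>] 0)

end FractalDimension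

section Operator

variable {V H : Type*} [NormedAddCommGroup V] [InnerProductSpace ℝ V] [CompleteSpace V]
  [NormedAddCommGroup H] [InnerProductSpace ℝ H]

/-- The duality map `A : V → V'`, `⟨A u, v⟩ = (u, v)_V`. -/
def dualityMap (u : V) : StrongDual ℝ V := InnerProductSpace.toDual ℝ V u

/-- The inclusion `H ⊂ V'` induced by the inclusion `ι : V → H`: `⟨h, v⟩ = (h, ι v)_H`. -/
def toDualOfH (ι : V →L[ℝ] H) (h : H) : StrongDual ℝ V := (innerSL ℝ h).comp ι

/-- `u` lies in the eigenspace of `A` for `μ`, that is `A u = μ u` in `V'`. -/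
def IsEigen (ι : V →L[ℝ] H) (μ : ℝ) (u : V) : Prop :=
  dualityMap u = μ • toDualOfH ι (ι u)

/-- The sum of the eigenspaces of `A` for the eigenvalues `μ ≤ Λ`. -/
def eigenSum (ι : V →L[ℝ] H) (Λ : ℝ) : Submodule ℝ V :=
  Submodule.span ℝ {u : V | ∃ μ : ℝ, μ ≤ Λ ∧ IsEigen ι μ u}

/-- The `j`-th term, `j = 1, 2, …`, of the nondecreasing sequence of the eigenvalues of `A`
repeated according to multiplicity: the least `Λ` such that at least `j` eigenvalues, counted
with multiplicity, are `≤ Λ`. -/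
def eigenvalue (ι : V →L[ℝ] H) (j : ℕ) : ℝ :=
  sInf {Λ : ℝ | (j : Cardinal) ≤ Module.rank ℝ (eigenSum ι Λ)}

/-- The growth assumption `λ_j ≥ c j ^ α` for all `j ≥ 1`, with `c, α > 0`. -/
structure GrowthCondition (ι : V →L[ℝ] H) (c α : ℝ) : Prop where
  c_pos : 0 < c
  α_pos : 0 < α
  le_eigenvalue : ∀ j : ℕ, 1 ≤ j → c * (j : ℝ) ^ α ≤ eigenvalue ι j

/-- A map `g : V → V'` is nondecreasing (monotone): `⟨g u - g v, u - v⟩ ≥ 0`. -/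
def IsMonotoneMap (g : V → StrongDual ℝ V) : Prop :=
  ∀ u v : V, 0 ≤ (g u - g v) (u - v)

/-- The set of solutions `u ∈ V` of `A u + g(u) = lam u` (an equality in `V'`). -/
def solutionSet (ι : V →L[ℝ] H) (g : V → StrongDual ℝ V) (lam : ℝ) : Set V :=
  {u : V | dualityMap u + g u = lam • toDualOfH ι (ι u)}

end Operator

end EllipsoidEntropy

end

/-! Monotonicity of `g` removes the nonlinearity: subtracting the equations of two solutions and
testing with u - v gives ‖u - v‖_V² ≤ λ |u - v|_H². Hence the points of K within H-distance r of a
solution v lie in a V-ball of radius √λ r about v, and a cover of the unit ball of V by small balls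
of H becomes, after translation and scaling, a cover of that piece of K. Thus K has the doubling
property `HalvingCover` at every scale with one constant N, and iteration gives at most C N^k balls
of radius 2^(-k), so the dimension is at most log₂ N.

To bound N, split V at the eigenvalue threshold Λ. Above it the Poincaré inequality makes the tail
small in H; below it the unit ball is, in the H-norm scaled by √Λ, an ellipsoid with half-axes
√(Λ/λ_i) ≥ 1, covered by volume comparison (`exists_cover_ellipsoid`). The growth condition and M^m
/ m! ≤ e^M then give log N ≤ (log 3 + α/2) M with M = (Λ/c)^(1/α) and Λ = 32λ. -/

/-! ### Covering ellipsoids by unit balls. -/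

section Ellipsoid

open MeasureTheory Metric

/-- The linear map of `ℝᵐ` that multiplies the `i`-th coordinate by `s i`. -/
def diagonalMap {m : ℕ} (s : Fin m → ℝ) : EuclideanSpace ℝ (Fin m) →ₗ[ℝ] EuclideanSpace ℝ (Fin m) :=
  Matrix.toLpLin 2 2 (Matrix.diagonal s)

theorem diagonalMap_apply {m : ℕ} (s : Fin m → ℝ) (x : EuclideanSpace ℝ (Fin m)) (i : Fin m) :
    diagonalMap s x i = s i * x i := by
  simp [diagonalMap, Matrix.toLpLin_apply, Matrix.mulVec_diagonal]

theorem det_diagonalMap {m : ℕ} (s : Fin m → ℝ) : LinearMap.det (diagonalMap s) = ∏ i, s i := by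
  rw [diagonalMap, Matrix.toLpLin_eq_toLin, LinearMap.det_toLin, Matrix.det_diagonal]

/-- The inverse of a diagonal map with entries at least 1 is a contraction, so the ellipsoid absorbs
balls. -/
theorem exists_diagonalMap_eq {m : ℕ} {s : Fin m → ℝ} (hs : ∀ i, 1 ≤ s i)
    (u : EuclideanSpace ℝ (Fin m)) : ∃ v, diagonalMap s v = u ∧ ‖v‖ ≤ ‖u‖ := by
  refine ⟨diagonalMap (fun i => (s i)⁻¹) u, ?_, ?_⟩
  · ext i
    have : s i ≠ 0 := by linarith [hs i]
    rw [diagonalMap_apply, diagonalMap_apply, mul_inv_cancel_left₀ this]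
  · rw [EuclideanSpace.norm_eq, EuclideanSpace.norm_eq]
    refine Real.sqrt_le_sqrt (Finset.sum_le_sum fun i _ => ?_)
    rw [diagonalMap_apply, norm_mul]
    gcongr
    have h1 : ‖(s i)⁻¹‖ ≤ 1 := by
      rw [norm_inv, Real.norm_of_nonneg (by linarith [hs i])]
      exact inv_le_one_of_one_le₀ (hs i)
    exact mul_le_of_le_one_left (norm_nonneg _) h1

/-- The volume bound for separated subsets of an ellipsoid whose half-axes are at least `1`. -/
theorem card_le_of_separated_in_ellipsoid {m : ℕ} {s : Fin m → ℝ} (hs : ∀ i, 1 ≤ s i)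
    (C : Finset (EuclideanSpace ℝ (Fin m)))
    (hC : ∀ y ∈ C, y ∈ diagonalMap s '' closedBall 0 1)
    (hsep : ∀ y ∈ C, ∀ z ∈ C, y ≠ z → 1 < dist y z) :
    (C.card : ℝ) ≤ 3 ^ m * ∏ i, s i := by
  set B : Set (EuclideanSpace ℝ (Fin m)) := closedBall 0 (1 / 2)
  have hdisj : (C : Set (EuclideanSpace ℝ (Fin m))).PairwiseDisjoint
      (fun y => closedBall y (1 / 2 : ℝ)) := by
    intro y hy z hz hyz
    refine closedBall_disjoint_closedBall ?_
    have := hsep y hy z hz hyz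
    linarith
  -- Each half-ball about a point of the ellipsoid stays in the 3/2-dilate; the ratio of 3/2 to 1/2
  -- produces the factor 3^m.
  have hsub : (⋃ y ∈ C, closedBall y (1 / 2 : ℝ)) ⊆ diagonalMap s '' closedBall 0 (3 * (1 / 2)) := by
    intro z hz
    simp only [Set.mem_iUnion] at hz
    obtain ⟨y, hy, hzy⟩ := hz
    obtain ⟨x, hx, rfl⟩ := hC y hy
    obtain ⟨v, hv, hvn⟩ := exists_diagonalMap_eq hs (z - diagonalMap s x)
    refine ⟨x + v, ?_, by rw [map_add, hv]; abel⟩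
    rw [mem_closedBall, dist_eq_norm] at hzy
    rw [mem_closedBall_zero_iff] at hx ⊢
    linarith [norm_add_le x v]
  have hpos : (0 : ℝ) ≤ ∏ i, s i := Finset.prod_nonneg fun i _ => by linarith [hs i]
  have key : (C.card : ℝ≥0∞) * volume B ≤ ENNReal.ofReal (3 ^ m * ∏ i, s i) * volume B := by
    calc (C.card : ℝ≥0∞) * volume B
        = ∑ y ∈ C, volume (closedBall y (1 / 2 : ℝ)) := by
          simp only [Measure.addHaar_closedBall_center, Finset.sum_const, nsmul_eq_mul, B]
      _ = volume (⋃ y ∈ C, closedBall y (1 / 2 : ℝ)) :=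
          (measure_biUnion_finset hdisj fun y _ => measurableSet_closedBall).symm
      _ ≤ volume (diagonalMap s '' closedBall 0 (3 * (1 / 2))) := measure_mono hsub
      _ = _ := by
          rw [Measure.addHaar_image_linearMap, det_diagonalMap, abs_of_nonneg hpos,
            Measure.addHaar_closedBall_mul_of_pos _ _ (by norm_num), finrank_euclideanSpace,
            Fintype.card_fin, ← mul_assoc, ← ENNReal.ofReal_mul hpos, mul_comm (∏ i, s i)]
  have hB0 : volume B ≠ 0 := (measure_closedBall_pos _ _ (by norm_num)).ne'
  have hBt : volume B ≠ ⊤ := measure_closedBall_lt_top.ne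
  rw [ENNReal.mul_le_mul_iff_left hB0 hBt] at key
  rw [← ENNReal.ofReal_natCast] at key
  exact (ENNReal.ofReal_le_ofReal_iff (by positivity)).1 key

/-- The unit covering number of an ellipsoid whose half-axes `s i` are at least `1` is bounded by
`3 ^ m * ∏ s i`. -/
theorem exists_cover_ellipsoid {m : ℕ} {s : Fin m → ℝ} (hs : ∀ i, 1 ≤ s i) :
    ∃ t : Finset (EuclideanSpace ℝ (Fin m)), (t.card : ℝ) ≤ 3 ^ m * ∏ i, s i ∧
      ∀ x, ‖x‖ ≤ 1 → ∃ y ∈ t, ‖diagonalMap s x - y‖ ≤ 1 := by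
  set A : Set (EuclideanSpace ℝ (Fin m)) := diagonalMap s '' closedBall 0 1
  have hfin : ∀ C : Finset (EuclideanSpace ℝ (Fin m)), (C : Set _) ⊆ A →
      IsSeparated ((1 : ℝ≥0) : ℝ≥0∞) (C : Set (EuclideanSpace ℝ (Fin m))) →
      (C.card : ℝ) ≤ 3 ^ m * ∏ i, s i := by
    intro C hCA hsep
    refine card_le_of_separated_in_ellipsoid hs C (fun y hy => hCA hy) fun y hy z hz hyz => ?_
    have h := hsep hy hz hyz
    simpa [edist_dist] using h
  -- Finite packing number makes a maximal separated set a genuine net. A larger, possibly infinite,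
  -- separated set is cut down to exactly one point more than the bound allows.
  have htop : packingNumber 1 A ≠ ⊤ := by
    refine ne_top_of_le_ne_top (ENat.natCast_ne_top ⌊3 ^ m * ∏ i, s i⌋₊) ?_
    refine iSup₂_le fun C hCA => iSup_le fun hsep => ?_
    by_contra! hlt
    obtain ⟨C', hC', hcard⟩ := Set.exists_subset_encard_eq
      (Order.add_one_le_of_lt hlt)
    have hC'fin : C'.Finite := Set.finite_of_encard_eq_coe (k := ⌊3 ^ m * ∏ i, s i⌋₊ + 1)
      (by rw [hcard]; rfl)
    have h := hfin hC'fin.toFinset (by simpa using hC'.trans hCA)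
      (by simpa using hsep.subset hC')
    rw [hC'fin.encard_eq_coe_toFinset_card] at hcard
    have hcard' : hC'fin.toFinset.card = ⌊3 ^ m * ∏ i, s i⌋₊ + 1 := by exact_mod_cast hcard
    rw [hcard'] at h
    push_cast at h
    linarith [Nat.lt_floor_add_one (3 ^ m * ∏ i, s i)]
  have hf : (maximalSeparatedSet 1 A).Finite := by
    rw [← Set.encard_ne_top_iff, encard_maximalSeparatedSet htop]
    exact htop
  refine ⟨hf.toFinset, hfin _ ?_ ?_, fun x hx => ?_⟩
  · simpa using maximalSeparatedSet_subset
  · rw [hf.coe_toFinset]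
    exact isSeparated_maximalSeparatedSet
  · have h := isCover_iff_subset_iUnion_closedBall.1 (isCover_maximalSeparatedSet htop)
      (Set.mem_image_of_mem (diagonalMap s) (mem_closedBall_zero_iff.2 hx))
    simp only [Set.mem_iUnion] at h
    obtain ⟨y, hy, hxy⟩ := h
    exact ⟨y, by simpa using hy, by simpa [dist_eq_norm] using hxy⟩

end Ellipsoid

/-! ### From doubling at all scales to fractal dimension. -/

section DoublingDimension

open EllipsoidEntropy Metric

variable {X : Type*} [PseudoMetricSpace X]

/-- Points of a set `K` in a ball of radius `r` centred in `K` are covered by `N` balls of radius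
`r / 2` centred in `K`. -/
def HalvingCover (K : Set X) (N : ℕ) : Prop :=
  ∀ x ∈ K, ∀ r : ℝ, 0 < r → ∃ t : Finset X, (t : Set X) ⊆ K ∧ t.card ≤ N ∧
    ∀ y ∈ K, dist y x ≤ r → ∃ z ∈ t, dist y z ≤ r / 2

/-- Since the new centres again lie in K, the halving can be repeated from a finite 1-net. -/
theorem HalvingCover.exists_cover {K : Set X} {N : ℕ} (h : HalvingCover K N)
    (hK : IsCompact K) : ∃ C : ℕ, 1 ≤ C ∧ ∀ k : ℕ, ∃ t : Finset X, (t : Set X) ⊆ K ∧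
      t.card ≤ C * N ^ k ∧ ∀ y ∈ K, ∃ z ∈ t, dist y z ≤ (1 / 2) ^ k := by
  classical
  obtain ⟨s, hsK, hsf, hs⟩ := exists_finite_isCover_of_isCompact (ε := 1) one_ne_zero hK
  -- The extra 1 keeps the constant positive when the net is empty.
  refine ⟨hsf.toFinset.card + 1, by omega, fun k => ?_⟩
  induction k with
  | zero =>
    refine ⟨hsf.toFinset, by simpa using hsK, by simp, fun y hy => ?_⟩
    have h := isCover_iff_subset_iUnion_closedBall.1 hs hy
    simp only [Set.mem_iUnion] at h
    obtain ⟨z, hz, hyz⟩ := h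
    exact ⟨z, by simpa using hz, by simpa using hyz⟩
  | succ k ih =>
    obtain ⟨t, htK, htc, ht⟩ := ih
    have hr : (0 : ℝ) < (1 / 2) ^ k := by positivity
    choose! f hfK hfc hf using fun x (hx : x ∈ K) => h x hx _ hr
    refine ⟨t.biUnion f, ?_, ?_, fun y hy => ?_⟩
    · intro z hz
      simp only [Finset.coe_biUnion, Set.mem_iUnion] at hz
      obtain ⟨x, hx, hzx⟩ := hz
      exact hfK x (htK hx) hzx
    · calc (t.biUnion f).card ≤ t.card * N :=
            Finset.card_biUnion_le_card_mul _ _ _ fun x hx => hfc x (htK hx)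
        _ ≤ _ := by rw [pow_succ, ← mul_assoc]; gcongr
    · obtain ⟨x, hx, hyx⟩ := ht y hy
      obtain ⟨z, hz, hyz⟩ := hf x (htK hx) y hy hyx
      exact ⟨z, Finset.mem_biUnion.2 ⟨x, hx, hz⟩, by rw [pow_succ]; linarith⟩

theorem entropy_le_of_cover {K : Set X} {ε : ℝ≥0} {n : ℕ} (hn : 1 ≤ n) (t : Finset X)
    (ht : t.card ≤ n) (hcov : ∀ y ∈ K, ∃ z ∈ t, dist y z ≤ ε) :
    entropy ε K ≤ ((Real.logb 2 n : ℝ) : EReal) := by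
  have hN : max 1 (externalCoveringNumber ε K) ≤ (n : ℕ∞) := by
    refine max_le (by exact_mod_cast hn) ?_
    refine (IsCover.externalCoveringNumber_le_encard (C := (t : Set X)) ?_).trans ?_
    · rw [isCover_iff_subset_iUnion_closedBall]
      intro y hy
      obtain ⟨z, hz, hyz⟩ := hcov y hy
      simp only [Set.mem_iUnion]
      exact ⟨z, hz, hyz⟩
    · rw [Set.encard_coe_eq_coe_finsetCard]
      exact_mod_cast ht
  have hlog2 : (0 : EReal) ≤ (Real.log 2 : EReal) := by
    exact_mod_cast Real.log_nonneg one_le_two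
  have hlog : ENNReal.log ((n : ℕ∞) : ℝ≥0∞) = (Real.log n : EReal) := by
    have : (((n : ℕ∞) : ℝ≥0∞)) = ENNReal.ofReal n := by simp
    rw [this, ENNReal.log_ofReal, if_neg]
    have : (1 : ℝ) ≤ n := by exact_mod_cast hn
    linarith
  rw [entropy, Real.logb, EReal.coe_div, ← hlog]
  refine EReal.div_le_div_right_of_nonneg hlog2 (ENNReal.log_monotone ?_)
  exact_mod_cast hN

theorem entropy_nonneg (ε : ℝ≥0) (K : Set X) : 0 ≤ entropy ε K := by
  have hlog2 : (0 : EReal) ≤ (Real.log 2 : EReal) := by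
    exact_mod_cast Real.log_nonneg one_le_two
  refine EReal.div_nonneg ?_ hlog2
  rw [← ENNReal.log_one]
  refine ENNReal.log_monotone ?_
  exact_mod_cast le_max_left _ _

theorem eventually_lt_half : ∀ᶠ ε : ℝ≥0 in 𝓝[>] 0, 0 < ε ∧ ε < 1 / 2 := by
  filter_upwards [self_mem_nhdsWithin, nhdsWithin_le_nhds (Iio_mem_nhds (half_pos one_pos))]
    with ε h1 h2 using ⟨h1, h2⟩

theorem one_lt_logb_inv {ε : ℝ≥0} (h0 : 0 < ε) (h : ε < 1 / 2) :
    1 < Real.logb 2 (1 / (ε : ℝ)) := by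
  have h0' : (0 : ℝ) < ε := h0
  have h' : (ε : ℝ) < 1 / 2 := by exact_mod_cast h
  rw [Real.lt_logb_iff_rpow_lt one_lt_two (by positivity), Real.rpow_one,
    lt_div_iff₀ h0']
  linarith

theorem fractalDim_nonneg (K : Set X) : 0 ≤ fractalDim K := by
  refine le_limsup_of_frequently_le (Eventually.frequently ?_)
  filter_upwards [eventually_lt_half] with ε hε
  refine EReal.div_nonneg (entropy_nonneg ε K) ?_
  exact_mod_cast (one_lt_logb_inv hε.1 hε.2).le.trans' zero_le_one

theorem HalvingCover.fractalDim_le {K : Set X} {N : ℕ} (hN : 1 ≤ N) (h : HalvingCover K N)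
    (hK : IsCompact K) : fractalDim K ≤ ((Real.logb 2 N : ℝ) : EReal) := by
  obtain ⟨C, hC1, hC⟩ := h.exists_cover hK
  set a : ℝ := Real.logb 2 C + Real.logb 2 N
  set L : ℝ≥0 → ℝ := fun ε => Real.logb 2 (1 / (ε : ℝ)) with hL
  have hN0 : 0 ≤ Real.logb 2 N := Real.logb_nonneg one_lt_two (by exact_mod_cast hN)
  have hbound : ∀ᶠ ε : ℝ≥0 in 𝓝[>] 0,
      entropy ε K / (L ε : EReal) ≤ ((a / L ε + Real.logb 2 N : ℝ) : EReal) := by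
    filter_upwards [eventually_lt_half] with ε hε
    have hL1 := one_lt_logb_inv hε.1 hε.2
    have hε0 : (0 : ℝ) < ε := hε.1
    -- With this exponent k the radius 2^(-k) is at most ε; rounding up costs one factor N, which is
    -- absorbed in `a` and disappears after division by `L ε` → ∞.
    obtain ⟨t, -, htc, ht⟩ := hC (⌊L ε⌋₊ + 1)
    have hk1 : (⌊L ε⌋₊ : ℝ) ≤ L ε := Nat.floor_le (by linarith)
    have hk2 : L ε < (⌊L ε⌋₊ + 1 : ℕ) := by push_cast; exact Nat.lt_floor_add_one _
    have hrad : (1 / 2 : ℝ) ^ (⌊L ε⌋₊ + 1) ≤ ε := by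
      rw [hL, Real.logb_lt_iff_lt_rpow one_lt_two (by positivity), Real.rpow_natCast] at hk2
      rw [one_div_pow]
      exact (one_div_le hε0 (by positivity)).1 hk2.le
    have hent : entropy ε K ≤ ((Real.logb 2 (C * N ^ (⌊L ε⌋₊ + 1) : ℕ) : ℝ) : EReal) :=
      entropy_le_of_cover (Nat.mul_pos hC1 (pow_pos hN _)) t htc fun y hy => by
        obtain ⟨z, hz, hyz⟩ := ht y hy
        exact ⟨z, hz, hyz.trans hrad⟩
    have hval : Real.logb 2 (C * N ^ (⌊L ε⌋₊ + 1) : ℕ) ≤ a + L ε * Real.logb 2 N := by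
      have hC0 : (C : ℝ) ≠ 0 := by exact_mod_cast (by omega : C ≠ 0)
      have hN0' : (N : ℝ) ≠ 0 := by exact_mod_cast (by omega : N ≠ 0)
      push_cast
      rw [Real.logb_mul hC0 (pow_ne_zero _ hN0'), Real.logb_pow]
      push_cast
      have := mul_le_mul_of_nonneg_right hk1 hN0
      simp only [a]
      linarith
    have hL0 : (0 : EReal) ≤ (L ε : EReal) := by exact_mod_cast (zero_le_one.trans hL1.le)
    refine (EReal.div_le_div_right_of_nonneg hL0
      (hent.trans (EReal.coe_le_coe_iff.2 hval))).trans_eq ?_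
    rw [← EReal.coe_div]
    congr 1
    have : L ε ≠ 0 := by linarith
    field_simp
  have htend : Tendsto (fun ε : ℝ≥0 => a / L ε + Real.logb 2 N) (𝓝[>] 0)
      (𝓝 (Real.logb 2 N)) := by
    have hLtop : Tendsto L (𝓝[>] 0) atTop := by
      have h1 : Tendsto (fun ε : ℝ≥0 => (ε : ℝ)) (𝓝[>] 0) (𝓝[>] 0) := by
        refine tendsto_nhdsWithin_iff.2 ⟨?_, ?_⟩
        · exact (NNReal.continuous_coe.tendsto 0).mono_left nhdsWithin_le_nhds
        · filter_upwards [self_mem_nhdsWithin] with ε hε using hε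
      have h2 : Tendsto (fun ε : ℝ≥0 => 1 / (ε : ℝ)) (𝓝[>] 0) atTop := by
        simpa only [one_div, Function.comp_def] using tendsto_inv_nhdsGT_zero.comp h1
      exact (Real.tendsto_logb_atTop one_lt_two).comp h2
    simpa using (hLtop.const_div_atTop a).add_const (Real.logb 2 N)
  refine (limsup_le_limsup hbound).trans_eq ?_
  exact ((continuous_coe_real_ereal.tendsto _).comp htend).limsup_eq

end DoublingDimension

/-! ### Spectral theory of the duality map through its compact inverse. -/

section Spectrum

open EllipsoidEntropy

variable {V H : Type*} [NormedAddCommGroup V] [InnerProductSpace ℝ V] [CompleteSpace V]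
  [NormedAddCommGroup H] [InnerProductSpace ℝ H]

local notation "⟪" x ", " y "⟫" => inner ℝ x y

theorem isEigen_iff_inner {ι : V →L[ℝ] H} {μ : ℝ} {u : V} :
    IsEigen ι μ u ↔ ∀ v, ⟪u, v⟫ = μ * ⟪ι u, ι v⟫ := by
  simp [IsEigen, ContinuousLinearMap.ext_iff, dualityMap, toDualOfH]

theorem eigenSum_eq_bot_of_neg (ι : V →L[ℝ] H) {Λ : ℝ} (h : Λ < 0) : eigenSum ι Λ = ⊥ := by
  refine Submodule.span_eq_bot.2 ?_
  rintro u ⟨μ, hμ, hu⟩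
  have h1 := isEigen_iff_inner.1 hu u
  rw [real_inner_self_eq_norm_sq, real_inner_self_eq_norm_sq] at h1
  have h2 : μ * ‖ι u‖ ^ 2 ≤ 0 := mul_nonpos_of_nonpos_of_nonneg (by linarith) (sq_nonneg _)
  have h3 : ‖u‖ ^ 2 = 0 := le_antisymm (by linarith) (sq_nonneg _)
  simpa using h3

theorem eigenvalue_le_of_le_rank (ι : V →L[ℝ] H) {n : ℕ} (hn : 1 ≤ n) {Λ : ℝ}
    (h : (n : Cardinal) ≤ Module.rank ℝ (eigenSum ι Λ)) : eigenvalue ι n ≤ Λ := by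
  -- The infimum is meaningful because no negative Λ is admissible when n ≥ 1.
  refine csInf_le ⟨0, fun Λ' (hΛ' : (n : Cardinal) ≤ _) => ?_⟩ h
  by_contra! hneg
  rw [eigenSum_eq_bot_of_neg ι hneg, rank_bot] at hΛ'
  have : n ≤ 0 := by exact_mod_cast hΛ'
  omega

theorem finiteDimensional_eigenSum {ι : V →L[ℝ] H} {c α : ℝ} (h : GrowthCondition ι c α) (Λ : ℝ) :
    FiniteDimensional ℝ (eigenSum ι Λ) := by
  rw [FiniteDimensional, ← Module.rank_lt_aleph0_iff]
  by_contra! hinf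
  have hle : ∀ n : ℕ, 1 ≤ n → c * (n : ℝ) ^ α ≤ Λ := fun n hn =>
    (h.le_eigenvalue n hn).trans
      (eigenvalue_le_of_le_rank ι hn ((Cardinal.natCast_lt_aleph0).le.trans hinf))
  have ht : Tendsto (fun n : ℕ => c * (n : ℝ) ^ α) atTop atTop :=
    ((tendsto_rpow_atTop h.α_pos).comp tendsto_natCast_atTop_atTop).const_mul_atTop h.c_pos
  obtain ⟨n, hn1, hn2⟩ := ((eventually_ge_atTop 1).and (ht.eventually_gt_atTop Λ)).exists
  exact (hle n hn1).not_gt hn2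

/-- The norm of a self-adjoint operator is its spectral radius, and the nonzero spectrum of a
compact operator consists of eigenvalues. -/
theorem norm_le_of_forall_hasEigenvalue {T : V →L[ℝ] V} (hT : IsCompactOperator T)
    (hT' : (T : V →ₗ[ℝ] V).IsSymmetric) {ρ : ℝ} (hρ : 0 ≤ ρ)
    (h : ∀ k : ℝ, k ≠ 0 → Module.End.HasEigenvalue (T : Module.End ℝ V) k → |k| ≤ ρ) :
    ‖T‖ ≤ ρ := by
  rw [← coe_nnnorm, ← Real.le_toNNReal_iff_coe_le hρ, ← ENNReal.coe_le_coe,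
    ← T.spectralRadius_eq_nnnorm hT'.isSelfAdjoint, spectralRadius]
  refine iSup₂_le fun k hk => ENNReal.coe_le_coe.2 ?_
  rw [Real.le_toNNReal_iff_coe_le hρ, coe_nnnorm, Real.norm_eq_abs]
  rcases eq_or_ne k 0 with rfl | hk0
  · simpa using hρ
  · exact h k hk0 ((hT.hasEigenvalue_iff_mem_spectrum hk0).2 hk)

variable [CompleteSpace H]

/-- The operator `ι* ι` on `V`, the inverse of the duality map. -/
noncomputable def gramOperator (ι : V →L[ℝ] H) : V →L[ℝ] V := ι.adjoint ∘L ι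

theorem inner_gramOperator_left (ι : V →L[ℝ] H) (u v : V) :
    ⟪gramOperator ι u, v⟫ = ⟪ι u, ι v⟫ := by
  simp [gramOperator, ContinuousLinearMap.adjoint_inner_left]

theorem inner_gramOperator_right (ι : V →L[ℝ] H) (u v : V) :
    ⟪u, gramOperator ι v⟫ = ⟪ι u, ι v⟫ := by
  simp [gramOperator, ContinuousLinearMap.adjoint_inner_right]

theorem gramOperator_isSymmetric (ι : V →L[ℝ] H) : (gramOperator ι : V →ₗ[ℝ] V).IsSymmetric :=
  fun u v => (inner_gramOperator_left ι u v).trans (inner_gramOperator_right ι u v).symm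

theorem isCompactOperator_gramOperator {ι : V →L[ℝ] H} (h : IsCompactOperator ι) :
    IsCompactOperator (gramOperator ι) :=
  h.clm_comp ι.adjoint

theorem isEigen_iff {ι : V →L[ℝ] H} {μ : ℝ} {u : V} :
    IsEigen ι μ u ↔ u = μ • gramOperator ι u := by
  rw [isEigen_iff_inner]
  constructor
  · intro h
    refine ext_inner_right ℝ fun v => ?_
    rw [h v, real_inner_smul_left, inner_gramOperator_left]
  · intro h v
    conv_lhs => rw [h]
    rw [real_inner_smul_left, inner_gramOperator_left]

theorem isEigen_inv {ι : V →L[ℝ] H} {τ : ℝ} (hτ : τ ≠ 0) {u : V}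
    (h : gramOperator ι u = τ • u) : IsEigen ι τ⁻¹ u := by
  rw [isEigen_iff, h, inv_smul_smul₀ hτ]

theorem pos_of_gramOperator_eq_smul {ι : V →L[ℝ] H} (hι : Function.Injective ι) {τ : ℝ} {u : V}
    (hu : u ≠ 0) (h : gramOperator ι u = τ • u) : 0 < τ := by
  have h1 := inner_gramOperator_left ι u u
  rw [h, real_inner_smul_left, real_inner_self_eq_norm_sq, real_inner_self_eq_norm_sq] at h1
  have h2 : 0 < ‖ι u‖ ^ 2 := by
    have : ι u ≠ 0 := fun h0 => hu (hι (h0.trans (map_zero ι).symm))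
    positivity
  rw [← h1] at h2
  exact pos_of_mul_pos_left h2 (sq_nonneg _)

theorem gramOperator_mem_eigenSum (ι : V →L[ℝ] H) (Λ : ℝ) :
    ∀ u ∈ eigenSum ι Λ, (gramOperator ι : V →ₗ[ℝ] V) u ∈ eigenSum ι Λ := by
  intro u hu
  suffices h : eigenSum ι Λ ≤ (eigenSum ι Λ).comap (gramOperator ι : V →ₗ[ℝ] V) from h hu
  refine Submodule.span_le.2 ?_
  rintro u ⟨μ, hμ, hu⟩
  have hu' := isEigen_iff.1 hu
  rcases eq_or_ne μ 0 with rfl | h0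
  · rw [zero_smul] at hu'
    simp [hu']
  · have : gramOperator ι u = μ⁻¹ • u := by
      conv_rhs => rw [hu']
      rw [inv_smul_smul₀ h0]
    have hmem : u ∈ eigenSum ι Λ := Submodule.subset_span ⟨μ, hμ, hu⟩
    change gramOperator ι u ∈ eigenSum ι Λ
    rw [this]
    exact Submodule.smul_mem _ _ hmem

theorem gramOperator_mem_eigenSum_orthogonal (ι : V →L[ℝ] H) (Λ : ℝ) :
    ∀ u ∈ (eigenSum ι Λ)ᗮ, (gramOperator ι : V →ₗ[ℝ] V) u ∈ (eigenSum ι Λ)ᗮ := by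
  intro u hu w hw
  rw [← gramOperator_isSymmetric ι w u]
  exact hu _ (gramOperator_mem_eigenSum ι Λ w hw)

/-- The Poincaré inequality on the orthogonal complement of the low eigenspaces. -/
theorem mul_norm_sq_le_of_mem_eigenSum_orthogonal {ι : V →L[ℝ] H} (hι : Function.Injective ι)
    (hιc : IsCompactOperator ι) {Λ : ℝ} (hΛ : 0 < Λ) {w : V} (hw : w ∈ (eigenSum ι Λ)ᗮ) :
    Λ * ‖ι w‖ ^ 2 ≤ ‖w‖ ^ 2 := by
  set p : Submodule ℝ V := (eigenSum ι Λ)ᗮ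
  have hinv := gramOperator_mem_eigenSum_orthogonal ι Λ
  let R : p →L[ℝ] p := (gramOperator ι).restrict hinv
  have hRc : IsCompactOperator R := (isCompactOperator_gramOperator hιc).restrict' hinv
  have hRs : (R : p →ₗ[ℝ] p).IsSymmetric := (gramOperator_isSymmetric ι).restrict_invariant hinv
  have hnorm : ‖R‖ ≤ Λ⁻¹ := by
    refine norm_le_of_forall_hasEigenvalue hRc hRs (by positivity) fun k hk0 hk => ?_
    obtain ⟨⟨v, hvp⟩, hv, hv0⟩ := hk.exists_hasEigenvector
    have hv0' : v ≠ 0 := fun h => hv0 (Subtype.ext h)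
    have hTv : gramOperator ι v = k • v :=
      congrArg Subtype.val (Module.End.mem_eigenspace_iff.1 hv)
    have hkpos := pos_of_gramOperator_eq_smul hι hv0' hTv
    rw [abs_of_pos hkpos]
    by_contra! hlt
    -- An eigenvalue k > 1/Λ would put v both in the low eigenspaces and in their complement.
    have hmem : v ∈ eigenSum ι Λ :=
      Submodule.subset_span ⟨k⁻¹, (inv_lt_of_inv_lt₀ hΛ hlt).le, isEigen_inv hk0 hTv⟩
    exact hv0' (inner_self_eq_zero.1 (hvp v hmem))
  have hRw : ‖ι w‖ ^ 2 ≤ Λ⁻¹ * ‖w‖ ^ 2 := by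
    have h1 : ⟪R ⟨w, hw⟩, (⟨w, hw⟩ : p)⟫ = ‖ι w‖ ^ 2 :=
      (inner_gramOperator_left ι w w).trans (real_inner_self_eq_norm_sq _)
    have h2 : ‖R ⟨w, hw⟩‖ ≤ Λ⁻¹ * ‖w‖ := R.le_of_opNorm_le hnorm ⟨w, hw⟩
    rw [← h1]
    refine (real_inner_le_norm _ _).trans ?_
    calc ‖R ⟨w, hw⟩‖ * ‖w‖ ≤ Λ⁻¹ * ‖w‖ * ‖w‖ := by gcongr
      _ = _ := by ring
  calc Λ * ‖ι w‖ ^ 2 ≤ Λ * (Λ⁻¹ * ‖w‖ ^ 2) := by gcongr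
    _ = ‖w‖ ^ 2 := mul_inv_cancel_left₀ hΛ.ne' _

/-- The low part of the spectrum: finitely many orthonormal eigenvectors for eigenvalues `(τ i)⁻¹`
at most `Λ`, which satisfy the growth condition, with a Poincaré inequality on their
orthogonal complement. -/
theorem exists_low_eigenvectors {ι : V →L[ℝ] H} (hι : Function.Injective ι)
    (hιc : IsCompactOperator ι) {c α : ℝ} (h : GrowthCondition ι c α) {Λ : ℝ} (hΛ : 0 < Λ) :
    ∃ (m : ℕ) (e : Fin m → V) (τ : Fin m → ℝ), Orthonormal ℝ e ∧
      (∀ i, gramOperator ι (e i) = τ i • e i) ∧ (∀ i, 1 ≤ Λ * τ i) ∧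
      (∀ i : Fin m, c * ((i : ℕ) + 1 : ℝ) ^ α * τ i ≤ 1) ∧
      ∀ w, (∀ i, ⟪e i, w⟫ = 0) → Λ * ‖ι w‖ ^ 2 ≤ ‖w‖ ^ 2 := by
  have := finiteDimensional_eigenSum h Λ
  have hS := (gramOperator_isSymmetric ι).restrict_invariant (gramOperator_mem_eigenSum ι Λ)
  set m := Module.finrank ℝ (eigenSum ι Λ) with hm
  let b := hS.eigenvectorBasis hm.symm
  set τ := hS.eigenvalues hm.symm with hτ
  have hon : Orthonormal ℝ (fun i => (b i : V)) :=
    b.orthonormal.comp_linearIsometry (eigenSum ι Λ).subtypeₗᵢ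
  have hT : ∀ i, gramOperator ι (b i : V) = τ i • (b i : V) := fun i =>
    congrArg Subtype.val (hS.apply_eigenvectorBasis hm.symm i)
  have hpos : ∀ i, 0 < τ i := fun i => pos_of_gramOperator_eq_smul hι (hon.ne_zero i) (hT i)
  refine ⟨m, fun i => b i, τ, hon, hT, fun i => ?_, fun i => ?_, fun w hw => ?_⟩
  · by_contra! hlt
    -- If Λ τ_i < 1, then b_i is orthogonal to every eigenvector generating the space that contains
    -- it.
    have horth : eigenSum ι Λ ≤ (ℝ ∙ (b i : V))ᗮ := by
      refine Submodule.span_le.2 ?_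
      rintro u ⟨μ, hμ, hu⟩
      rw [SetLike.mem_coe, Submodule.mem_orthogonal_singleton_iff_inner_right]
      have h1 : ⟪(b i : V), u⟫ = μ * (τ i * ⟪(b i : V), u⟫) := by
        conv_lhs => rw [isEigen_iff.1 hu]
        rw [real_inner_smul_right, inner_gramOperator_right, ← inner_gramOperator_left, hT,
          real_inner_smul_left]
      have h2 : μ * τ i < 1 := (mul_le_mul_of_nonneg_right hμ (hpos i).le).trans_lt hlt
      have h3 : (1 - μ * τ i) * ⟪(b i : V), u⟫ = 0 := by linarith
      exact (mul_eq_zero.1 h3).resolve_left (by linarith)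
    have h0 := (Submodule.mem_orthogonal_singleton_iff_inner_right).1 (horth (b i).2)
    exact hon.ne_zero i (inner_self_eq_zero.1 h0)
  -- The τ are nonincreasing, so b_0, …, b_i all have eigenvalues at most 1/τ_i; indices start at 0,
  -- hence i + 1.
  · have hrank : ((i + 1 : ℕ) : Cardinal) ≤ Module.rank ℝ (eigenSum ι (τ i)⁻¹) := by
      let f : Fin (i + 1) → eigenSum ι (τ i)⁻¹ := fun j =>
        ⟨b (j.castLE i.2), Submodule.subset_span ⟨(τ (j.castLE i.2))⁻¹,
          inv_anti₀ (hpos i) (hS.eigenvalues_antitone hm.symm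
            (Fin.le_def.2 (Nat.lt_succ_iff.1 j.2))),
          isEigen_inv (hpos _).ne' (hT _)⟩⟩
      have hf : LinearIndependent ℝ f := by
        refine LinearIndependent.of_comp (eigenSum ι (τ i)⁻¹).subtype ?_
        exact hon.linearIndependent.comp _ (Fin.castLE_injective i.2)
      simpa using hf.cardinal_lift_le_rank
    have h1 := (h.le_eigenvalue _ (by omega)).trans
      (eigenvalue_le_of_le_rank ι (by omega) hrank)
    push_cast at h1
    calc _ ≤ (τ i)⁻¹ * τ i := mul_le_mul_of_nonneg_right h1 (hpos i).le
      _ = 1 := inv_mul_cancel₀ (hpos i).ne'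
  · refine mul_norm_sq_le_of_mem_eigenSum_orthogonal hι hιc hΛ ?_
    intro u hu
    have h1 : u = ∑ i, ⟪b i, (⟨u, hu⟩ : eigenSum ι Λ)⟫ • (b i : V) := by
      have := congrArg Subtype.val (b.sum_repr' ⟨u, hu⟩)
      simpa using this.symm
    rw [h1, sum_inner]
    refine Finset.sum_eq_zero fun i _ => ?_
    rw [real_inner_smul_left, hw i, mul_zero]

end Spectrum

/-! ### Entropy of the unit ball of V, and doubling for the solution set. -/

section SolutionSet

open EllipsoidEntropy Metric

local notation "⟪" x ", " y "⟫" => inner ℝ x y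

/-- Each half-axis is at most (M/(i+1))^(α/2), so the product is at most (M^m / m!)^(α/2) ≤
e^(αM/2). The last index gives m ≤ M, which bounds 3^m. -/
theorem three_pow_mul_prod_sqrt_le {c α Λ : ℝ} (hc : 0 < c) (hα : 0 < α) (hΛ : 0 < Λ) {m : ℕ}
    {τ : Fin m → ℝ} (h1 : ∀ i, 1 ≤ Λ * τ i)
    (h2 : ∀ i : Fin m, c * ((i : ℕ) + 1 : ℝ) ^ α * τ i ≤ 1) :
    3 ^ m * ∏ i, √(Λ * τ i) ≤ Real.exp ((Real.log 3 + α / 2) * (Λ / c) ^ (1 / α)) := by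
  set M : ℝ := (Λ / c) ^ (1 / α)
  have hM0 : 0 ≤ M := by positivity
  have hMα : M ^ α = Λ / c := by
    rw [← Real.rpow_mul (by positivity), one_div_mul_cancel hα.ne', Real.rpow_one]
  have hle : ∀ i : Fin m, c * ((i : ℕ) + 1 : ℝ) ^ α * (Λ * τ i) ≤ Λ := fun i => by
    have := mul_le_mul_of_nonneg_left (h2 i) hΛ.le
    linarith
  have hm : (m : ℝ) ≤ M := by
    rcases Nat.eq_zero_or_pos m with rfl | hm
    · simpa using hM0
    · have h := hle ⟨m - 1, by omega⟩
      have hcast : ((m - 1 : ℕ) : ℝ) + 1 = m := by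
        rw [Nat.cast_sub hm]
        simp
      simp only [hcast] at h
      have hcm : 0 ≤ c * (m : ℝ) ^ α := by positivity
      have h' : c * (m : ℝ) ^ α ≤ Λ := (le_mul_of_one_le_right hcm (h1 _)).trans h
      rw [← Real.rpow_le_rpow_iff (by positivity) hM0 hα, hMα, le_div_iff₀ hc]
      linarith
  have hsqrt : ∀ i : Fin m, √(Λ * τ i) ≤ (M / ((i : ℕ) + 1 : ℝ)) ^ (α / 2) := fun i => by
    have hi : (0 : ℝ) < ((i : ℕ) + 1 : ℝ) ^ α := by positivity
    have hdiv : Λ * τ i ≤ (M / ((i : ℕ) + 1 : ℝ)) ^ α := by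
      rw [Real.div_rpow hM0 (by positivity), hMα, le_div_iff₀ hi, le_div_iff₀ hc]
      linarith [hle i]
    have heq : (M / ((i : ℕ) + 1 : ℝ)) ^ (α / 2) = √((M / ((i : ℕ) + 1 : ℝ)) ^ α) := by
      rw [Real.sqrt_eq_rpow, ← Real.rpow_mul (by positivity)]
      congr 1
      ring
    rw [heq]
    exact Real.sqrt_le_sqrt hdiv
  have hprod : ∏ i : Fin m, (M / ((i : ℕ) + 1 : ℝ)) = M ^ m / (m.factorial : ℝ) := by
    rw [Finset.prod_div_distrib, Finset.prod_const, Finset.card_univ, Fintype.card_fin,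
      Fin.prod_univ_eq_prod_range (fun i : ℕ => (i : ℝ) + 1) m]
    congr 1
    exact_mod_cast Finset.prod_range_add_one_eq_factorial m
  have h3 : (3 : ℝ) ^ m ≤ Real.exp (Real.log 3 * M) := by
    rw [Real.exp_mul, Real.exp_log (by norm_num), ← Real.rpow_natCast]
    exact Real.rpow_le_rpow_of_exponent_le (by norm_num) hm
  have h4 : ∏ i, √(Λ * τ i) ≤ Real.exp (α / 2 * M) := by
    calc ∏ i, √(Λ * τ i) ≤ ∏ i : Fin m, (M / ((i : ℕ) + 1 : ℝ)) ^ (α / 2) :=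
          Finset.prod_le_prod (fun i _ => Real.sqrt_nonneg _) fun i _ => hsqrt i
      _ = (M ^ m / (m.factorial : ℝ)) ^ (α / 2) := by
          rw [Real.finsetProd_rpow _ _ (fun i _ => by positivity), hprod]
      _ ≤ (Real.exp M) ^ (α / 2) :=
          Real.rpow_le_rpow (by positivity) (Real.pow_div_factorial_le_exp M hM0 m) (by positivity)
      _ = Real.exp (α / 2 * M) := by rw [← Real.exp_mul, mul_comm]
  rw [add_mul, Real.exp_add]
  exact mul_le_mul h3 h4 (Finset.prod_nonneg fun i _ => Real.sqrt_nonneg _) (Real.exp_pos _).le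

variable {V H : Type*} [NormedAddCommGroup V] [InnerProductSpace ℝ V] [CompleteSpace V]
  [NormedAddCommGroup H] [InnerProductSpace ℝ H]

/-- The entropy bound for the unit ball of `V` in `H`. -/
theorem exists_cover_unitBall [CompleteSpace H] {ι : V →L[ℝ] H} (hι : Function.Injective ι)
    (hιc : IsCompactOperator ι) {c α : ℝ} (h : GrowthCondition ι c α) {Λ : ℝ} (hΛ : 0 < Λ) :
    ∃ t : Finset H, (t.card : ℝ) ≤ Real.exp ((Real.log 3 + α / 2) * (Λ / c) ^ (1 / α)) ∧
      ∀ w : V, ‖w‖ ≤ 1 → ∃ y ∈ t, Λ * ‖ι w - y‖ ^ 2 ≤ 2 := by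
  classical
  obtain ⟨m, e, τ, he, hT, hτ1, hτ2, hort⟩ := exists_low_eigenvectors hι hιc h hΛ
  have hs1 : ∀ i, 1 ≤ √(Λ * τ i) := fun i => Real.one_le_sqrt.2 (hτ1 i)
  obtain ⟨t, htc, ht⟩ := exists_cover_ellipsoid hs1
  -- Dividing by √(Λ τ_i) turns a point near the ellipsoid back into coordinates along the e_i.
  refine ⟨t.image fun y => ι (∑ i, (y i / √(Λ * τ i)) • e i), ?_, fun w hw => ?_⟩
  · refine le_trans ?_ (htc.trans (three_pow_mul_prod_sqrt_le h.c_pos h.α_pos hΛ hτ1 hτ2))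
    exact_mod_cast Finset.card_image_le
  have hbessel : ∑ i, ⟪e i, w⟫ ^ 2 ≤ 1 := by
    have := he.sum_inner_products_le w (s := Finset.univ)
    simp only [Real.norm_eq_abs, sq_abs] at this
    nlinarith [norm_nonneg w]
  obtain ⟨y, hy, hxy⟩ := ht (WithLp.toLp 2 fun i => ⟪e i, w⟫) (by
    rw [EuclideanSpace.norm_eq, Real.sqrt_le_one]
    simpa using hbessel)
  refine ⟨_, Finset.mem_image_of_mem _ hy, ?_⟩
  set w₁ := ∑ i, ⟪e i, w⟫ • e i with hw₁
  set z := ∑ i, (y i / √(Λ * τ i)) • e i with hz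
  set d : Fin m → ℝ := fun i => ⟪e i, w⟫ - y i / √(Λ * τ i) with hd
  have hdz : w₁ - z = ∑ i, d i • e i := by
    simp only [hw₁, hz, hd, sub_smul, Finset.sum_sub_distrib]
  have hw₂ : ∀ i, ⟪e i, w - w₁⟫ = 0 := fun i => by
    rw [inner_sub_right, hw₁, he.inner_right_fintype, sub_self]
  have hw₂n : ‖w - w₁‖ ^ 2 ≤ 1 := by
    have h1 : ⟪w₁, w - w₁⟫ = 0 := by
      rw [hw₁, sum_inner]
      refine Finset.sum_eq_zero fun i _ => ?_
      rw [real_inner_smul_left, hw₂ i, mul_zero]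
    have h2 := norm_add_sq_eq_norm_sq_add_norm_sq_real h1
    rw [add_sub_cancel] at h2
    nlinarith [norm_nonneg w, norm_nonneg w₁]
  have htail : Λ * ‖ι (w - w₁)‖ ^ 2 ≤ 1 := (hort _ hw₂).trans hw₂n
  have hιe : ∀ i v, ⟪ι (e i), ι v⟫ = τ i * ⟪e i, v⟫ := fun i v => by
    rw [← inner_gramOperator_left, hT, real_inner_smul_left]
  -- Head and tail are orthogonal in H as well, the e_i being eigenvectors; so the errors 1 and 1
  -- add up to 2.
  have hcross : ⟪ι (w₁ - z), ι (w - w₁)⟫ = 0 := by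
    rw [hdz, map_sum, sum_inner]
    refine Finset.sum_eq_zero fun i _ => ?_
    rw [map_smul, real_inner_smul_left, hιe, hw₂ i, mul_zero, mul_zero]
  have hhead : Λ * ‖ι (w₁ - z)‖ ^ 2 ≤ 1 := by
    have h1 : ‖ι (w₁ - z)‖ ^ 2 = ∑ i, τ i * d i ^ 2 := by
      rw [← real_inner_self_eq_norm_sq]
      conv_lhs => rw [hdz, map_sum, sum_inner]
      refine Finset.sum_congr rfl fun i _ => ?_
      rw [map_smul, real_inner_smul_left, ← map_sum, hιe, he.inner_right_fintype]
      ring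
    have h2 := pow_le_one₀ (n := 2) (norm_nonneg _) hxy
    rw [EuclideanSpace.norm_sq_eq] at h2
    refine le_trans (le_of_eq ?_) h2
    rw [h1, Finset.mul_sum]
    refine Finset.sum_congr rfl fun i _ => ?_
    rw [PiLp.sub_apply, diagonalMap_apply, Real.norm_eq_abs, sq_abs]
    have hpos : 0 < √(Λ * τ i) := by linarith [hs1 i]
    have hsq : √(Λ * τ i) ^ 2 = Λ * τ i := Real.sq_sqrt (by linarith [hτ1 i])
    have h3 : √(Λ * τ i) * ⟪e i, w⟫ - y i = √(Λ * τ i) * d i := by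
      simp only [hd]
      field_simp
    change Λ * (τ i * d i ^ 2) = (√(Λ * τ i) * ⟪e i, w⟫ - y i) ^ 2
    rw [h3, mul_pow, hsq]
    ring
  have hsum : ι w - ι z = ι (w₁ - z) + ι (w - w₁) := by
    rw [← map_add, ← map_sub]
    congr 1
    abel
  have hpyth := norm_add_sq_eq_norm_sq_add_norm_sq_real hcross
  rw [hsum, sq, hpyth]
  linarith

/-- Differences of solutions satisfy a reverse Poincaré inequality. -/
theorem norm_sub_sq_le_of_mem_solutionSet {ι : V →L[ℝ] H} {g : V → StrongDual ℝ V}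
    (hg : IsMonotoneMap g) {lam : ℝ} {u v : V} (hu : u ∈ solutionSet ι g lam)
    (hv : v ∈ solutionSet ι g lam) : ‖u - v‖ ^ 2 ≤ lam * ‖ι u - ι v‖ ^ 2 := by
  have hu' := congrArg (fun f : StrongDual ℝ V => f (u - v)) hu
  have hv' := congrArg (fun f : StrongDual ℝ V => f (u - v)) hv
  have hmon := hg u v
  simp only [add_apply, smul_apply, dualityMap, toDualOfH,
    InnerProductSpace.toDual_apply_apply, ContinuousLinearMap.comp_apply, innerSL_apply_apply,
    smul_eq_mul, sub_apply] at hu' hv' hmon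
  rw [← real_inner_self_eq_norm_sq, ← real_inner_self_eq_norm_sq, inner_sub_left u v,
    inner_sub_left (ι u), ← map_sub]
  linarith

/-- Replacing each useful centre by a point of K in its ball at most doubles the radius, whence the
quarter. -/
theorem halvingCover_of_quarter {X : Type*} [PseudoMetricSpace X] {K : Set X} {N : ℕ}
    (h : ∀ x ∈ K, ∀ r : ℝ, 0 < r → ∃ t : Finset X, t.card ≤ N ∧
      ∀ y ∈ K, dist y x ≤ r → ∃ z ∈ t, dist y z ≤ r / 4) : HalvingCover K N := by
  classical
  intro x hx r hr
  obtain ⟨t, htc, ht⟩ := h x hx r hr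
  choose! f hfK hf using fun z (hz : ∃ y ∈ K, dist y z ≤ r / 4) => hz
  refine ⟨(t.filter fun z => ∃ y ∈ K, dist y z ≤ r / 4).image f, ?_,
    Finset.card_image_le.trans ((Finset.card_filter_le _ _).trans htc), fun y hy hyx => ?_⟩
  · intro y hy
    obtain ⟨z, hz, rfl⟩ := Finset.mem_image.1 hy
    exact hfK z (Finset.mem_filter.1 hz).2
  · obtain ⟨z, hz, hyz⟩ := ht y hy hyx
    refine ⟨f z, Finset.mem_image_of_mem f (Finset.mem_filter.2 ⟨hz, y, hy, hyz⟩), ?_⟩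
    have := hf z ⟨y, hy, hyz⟩
    linarith [dist_triangle_right y (f z) z]

theorem halvingCover_of_subset_solutionSet [CompleteSpace H] {ι : V →L[ℝ] H}
    (hι : Function.Injective ι) (hιc : IsCompactOperator ι) {c α : ℝ}
    (h : GrowthCondition ι c α) {g : V → StrongDual ℝ V} (hg : IsMonotoneMap g) {lam : ℝ}
    (hlam : 0 < lam) {K : Set H} (hK : K ⊆ ι '' solutionSet ι g lam) :
    HalvingCover K ⌊Real.exp ((Real.log 3 + α / 2) * (32 * lam / c) ^ (1 / α))⌋₊ := by
  classical
  -- The choice Λ = 32λ makes the scaled squared error λ r² · 2/Λ equal to (r/4)².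
  obtain ⟨t, htc, ht⟩ := exists_cover_unitBall hι hιc h (Λ := 32 * lam) (by positivity)
  refine halvingCover_of_quarter fun x hx r hr => ?_
  obtain ⟨v, hv, rfl⟩ := hK hx
  have hρ : 0 < √lam * r := mul_pos (Real.sqrt_pos.2 hlam) hr
  have hρsq : (√lam * r) ^ 2 = lam * r ^ 2 := by rw [mul_pow, Real.sq_sqrt hlam.le]
  refine ⟨t.image fun y => ι v + (√lam * r) • y, Finset.card_image_le.trans (Nat.le_floor htc),
    fun y hy hyv => ?_⟩
  obtain ⟨u, hu, rfl⟩ := hK hy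
  rw [dist_eq_norm] at hyv
  have hnorm : ‖u - v‖ ≤ √lam * r := by
    refine le_of_sq_le_sq ?_ hρ.le
    rw [hρsq]
    refine (norm_sub_sq_le_of_mem_solutionSet hg hu hv).trans ?_
    gcongr
  obtain ⟨z, hz, hzw⟩ := ht ((√lam * r)⁻¹ • (u - v)) (by
    rw [norm_smul, norm_inv, Real.norm_of_nonneg hρ.le, inv_mul_le_one₀ hρ]
    exact hnorm)
  refine ⟨_, Finset.mem_image_of_mem _ hz, ?_⟩
  have heq : ι u - (ι v + (√lam * r) • z) =
      (√lam * r) • (ι ((√lam * r)⁻¹ • (u - v)) - z) := by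
    rw [map_smul, smul_sub, smul_inv_smul₀ hρ.ne', map_sub]
    abel
  rw [dist_eq_norm]
  refine le_of_sq_le_sq ?_ (by positivity)
  rw [heq, norm_smul, Real.norm_of_nonneg hρ.le, mul_pow, hρsq]
  have := mul_le_mul_of_nonneg_left hzw (sq_nonneg r)
  nlinarith

end SolutionSet

/-! ### The dimension bound. -/

open EllipsoidEntropy in
theorem theorem3 {H V : Type*}
    [NormedAddCommGroup H] [InnerProductSpace ℝ H] [CompleteSpace H]
    [TopologicalSpace.SeparableSpace H]
    [NormedAddCommGroup V] [InnerProductSpace ℝ V] [CompleteSpace V]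
    (ι : V →L[ℝ] H) (hι_inj : Function.Injective ι) (hι_dense : DenseRange ι)
    (hι_compact : IsCompactOperator ι)
    (hH : ¬ FiniteDimensional ℝ H)
    (c α : ℝ) (hH1 : GrowthCondition ι c α)
    (g : V → StrongDual ℝ V) (hg_cont : Continuous g) (hg_mono : IsMonotoneMap g)
    (lam : ℝ) (hlam : 0 < lam)
    (K : Set H) (hK_compact : IsCompact K) (hK : K ⊆ ι '' solutionSet ι g lam) :
    ∃ d : ℝ, fractalDim K = (d : EReal) ∧
      d < ((Real.log 3 + α) / Real.log 2) * (32 * lam / c) ^ (1 / α) := by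
  have hα := hH1.α_pos
  have hM : 0 < (32 * lam / c) ^ (1 / α) :=
    Real.rpow_pos_of_pos (div_pos (by positivity) hH1.c_pos) _
  have hlog3 : 0 < Real.log 3 := Real.log_pos (by norm_num)
  have hlog2 : 0 < Real.log 2 := Real.log_pos one_lt_two
  set M := (32 * lam / c) ^ (1 / α)
  set E := (Real.log 3 + α / 2) * M
  have hcover := halvingCover_of_subset_solutionSet hι_inj hι_compact hH1 hg_mono hlam hK
  have hN : 1 ≤ ⌊Real.exp E⌋₊ :=
    Nat.le_floor (by simpa using Real.one_le_exp (by positivity : 0 ≤ E))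
  have hle := hcover.fractalDim_le hN hK_compact
  have h0 := fractalDim_nonneg K
  -- The bounds 0 and log₂ N exclude ±∞, where `toReal` would return a default value.
  have hcoe : ((fractalDim K).toReal : EReal) = fractalDim K :=
    EReal.coe_toReal (ne_top_of_le_ne_top (EReal.coe_ne_top _) hle)
      (ne_bot_of_le_ne_bot EReal.zero_ne_bot h0)
  refine ⟨(fractalDim K).toReal, hcoe.symm, ?_⟩
  rw [← hcoe, EReal.coe_le_coe_iff] at hle
  have hlogN : Real.log ⌊Real.exp E⌋₊ ≤ E := by
    rw [Real.log_le_iff_le_exp (by exact_mod_cast hN)]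
    exact Nat.floor_le (Real.exp_pos _).le
  calc (fractalDim K).toReal ≤ Real.logb 2 ⌊Real.exp E⌋₊ := hle
    _ ≤ E / Real.log 2 := div_le_div_of_nonneg_right hlogN hlog2.le
    -- Strictness comes from α/2 < α and M > 0.
    _ < (Real.log 3 + α) * M / Real.log 2 := by
        refine div_lt_div_of_pos_right ?_ hlog2
        exact mul_lt_mul_of_pos_right (by linarith) hM
    _ = _ := by ring
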